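/- Theorem. Let $m\ge 0$ bidders compete for a single item. Bidder $i$ has a finite type set $T_i$ and her type $t_i$ is drawn from a probability distribution $\mathcal D_i$ on $T_i$; the types of different bidders are independent. A (randomized) mechanism $M$ maps each type profile $t\in\prod_i T_i$ to numbers $M_i(t)\ge 0$ with $\sum_i M_i(t)\le 1$, where $M_i(t)$ is the probability that bidder $i$ receives the item; write $M_i(A)=\mathbb E_{t_{-i}\sim\prod_{j\ne i}\mathcal D_j}[M_i(A,t_{-i})]$ for $A\in T_i$. A reduced form is a family $\pi=(\pi_i)_i$ of functions $\pi_i:T_i\to[0,1]$. The mechanism $M$ implements $\pi$ if $M_i(A)\ge\pi_i(A)$ for all $i$ and all $A\in T_i$, and $\pi$ is feasible if some mechanism implements it. Put $N=\sum_i|T_i|$. A hierarchical mechanism is given by a function $H:\bigcup_i(T_i\times\{i\})\to\{1,\dots,N\}\cup\{\mathrm{LOSE}\}$, where $\mathrm{LOSE}$ is larger than $N$: on the type profile $(A_1,\dots,A_m)$ the item is thrown away if $H(A_i,i)=\mathrm{LOSE}$ for all $i$, and otherwise it is awarded uniformly at random to a bidder in $\arg\min_i H(A_i,i)$. A total ordering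 is a bijection $\sigma:\bigcup_i(T_i\times\{i\})\to\{1,\dots,N\}$. It respects $\pi$ if for all $i$ and $A,B\in T_i$, $\pi_i(A)>\pi_i(B)$ implies $\sigma(A,i)<\sigma(B,i)$. The hierarchical mechanism $H$ is $\sigma$-ordered if for all $(A,i),(B,j)$, $\sigma(A,i)<\sigma(B,j)$ implies $H(A,i)\le H(B,j)$. If the reduced form $\pi$ is feasible, then there exist a total ordering $\sigma$ of $\bigcup_i(T_i\times\{i\})$ that respects $\pi$ and a probability distribution over $\sigma$-ordered hierarchical mechanisms such that the mechanism that samples a hierarchical mechanism from this distribution and runs it implements $\pi$. -/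

import Mathlib

namespace SingleItem

section Basics

variable {ι : Type*} [Fintype ι] [DecidableEq ι]
variable {T : ι → Type*} [∀ i, Fintype (T i)] [∀ i, DecidableEq (T i)]

/-- A reduced form: for every bidder `i` and type `A` of bidder `i`, a probability
`π i A ∈ [0,1]` with which bidder `i` should receive the item when reporting `A`. -/
def IsReducedForm (π : ∀ i, T i → ℝ) : Prop :=
  ∀ i A, π i A ∈ Set.Icc (0 : ℝ) 1

variable (T) in
/-- A (randomized, direct) feasible single-item mechanism: on the reported type profile `t`,
bidder `i` receives the item with probability `alloc t i`; the item is never over-allocated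
(with probability `1 - ∑ i, alloc t i` it is thrown away). -/
@[ext]
structure Mechanism where
  alloc : (∀ i, T i) → ι → ℝ
  alloc_nonneg : ∀ t i, 0 ≤ alloc t i
  sum_alloc_le_one : ∀ t, ∑ i, alloc t i ≤ 1

/-- The probability `M_i(A)` that bidder `i` receives the item when reporting type `A`, over the
randomness of the mechanism and of the other bidders' truthfully reported types, which are
independent, bidder `j`'s type being distributed according to `D j`. -/
noncomputable def Mechanism.interim (M : Mechanism T) (D : ∀ i, T i → ℝ) (i : ι) (A : T i) : ℝ :=
  ∑ t : (∀ j, T j) with t i = A, (∏ j ∈ Finset.univ.erase i, D j (t j)) * M.alloc t i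

/-- `M` implements `π` (when types are independent with distributions `D i`):
`M_i(A) ≥ π_i(A)` for all bidders `i` and types `A`. -/
def Mechanism.Implements (M : Mechanism T) (D : ∀ i, T i → ℝ) (π : ∀ i, T i → ℝ) : Prop :=
  ∀ i A, π i A ≤ M.interim D i A

/-- `π` is feasible if some mechanism implements it. -/
def Feasible (D : ∀ i, T i → ℝ) (π : ∀ i, T i → ℝ) : Prop :=
  ∃ M : Mechanism T, M.Implements D π

variable (T) in
/-- The data of a hierarchical mechanism: a map from all (bidder, type) pairs to the levels
`[∑ i, |T i|] ∪ {LOSE}`, where `LOSE` is the top element `⊤`, larger than every other level. -/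
abbrev Hierarchy := (Σ i, T i) → WithTop (Fin (∑ i, Fintype.card (T i)))

/-- The bidders in `argmin_i H(t_i, i)`, or no bidder if `H(t_i, i) = LOSE` for all `i`. -/
def Hierarchy.winners (H : Hierarchy T) (t : ∀ i, T i) : Finset ι :=
  {i | H ⟨i, t i⟩ ≠ ⊤ ∧ ∀ j, H ⟨i, t i⟩ ≤ H ⟨j, t j⟩}

/-- The hierarchical mechanism of `H`: the item is awarded uniformly at random to a bidder in
`argmin_i H(t_i, i)`, and is thrown away if `H(t_i, i) = LOSE` for all `i`. -/
noncomputable def Hierarchy.toMechanism (H : Hierarchy T) : Mechanism T where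
  alloc t i := if i ∈ H.winners t then ((H.winners t).card : ℝ)⁻¹ else 0
  alloc_nonneg t i := by
    split_ifs
    · positivity
    · exact le_rfl
  sum_alloc_le_one t := by
    rw [Finset.sum_ite_mem, Finset.univ_inter, Finset.sum_const, nsmul_eq_mul]
    exact mul_inv_le_one

/-- The mechanism that samples a hierarchy `H` with probability `w H` and runs the hierarchical
mechanism of `H`; here `w` is a probability distribution on hierarchies. -/
noncomputable def mixture (w : Hierarchy T → ℝ) (hw : w ∈ stdSimplex ℝ (Hierarchy T)) :
    Mechanism T where
  alloc t i := ∑ H, w H * H.toMechanism.alloc t i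
  alloc_nonneg t i :=
    Finset.sum_nonneg fun H _ => mul_nonneg (hw.1 H) (H.toMechanism.alloc_nonneg t i)
  sum_alloc_le_one t := by
    rw [Finset.sum_comm]
    simp_rw [← Finset.mul_sum]
    calc ∑ H, w H * ∑ i, H.toMechanism.alloc t i ≤ ∑ H, w H * 1 :=
          Finset.sum_le_sum fun H _ =>
            mul_le_mul_of_nonneg_left (H.toMechanism.sum_alloc_le_one t) (hw.1 H)
      _ = 1 := by simpa using hw.2

variable (T) in
/-- A total ordering of all (bidder, type) pairs: a bijection onto the positions
`[∑ i, |T i|]`. -/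
abbrev TotalOrdering := (Σ i, T i) ≃ Fin (∑ i, Fintype.card (T i))

/-- `σ` respects `π`: for types `A`, `B` of the same bidder `i`,
`π_i(A) > π_i(B)` implies `σ(A, i) < σ(B, i)`. -/
def TotalOrdering.Respects (σ : TotalOrdering T) (π : ∀ i, T i → ℝ) : Prop :=
  ∀ (i : ι) (A B : T i), π i B < π i A → σ ⟨i, A⟩ < σ ⟨i, B⟩

/-- `H` is `σ`-ordered: `σ(A, i) < σ(B, j)` implies `H(A, i) ≤ H(B, j)`. -/
def Hierarchy.IsOrdered (H : Hierarchy T) (σ : TotalOrdering T) : Prop :=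
  ∀ x y : (Σ i, T i), σ x < σ y → H x ≤ H y

end Basics

end SingleItem

/-!
Suppose first that every type has positive probability, and put `x(i, A) = D_i(A) π_i(A)`. Let
`f(S)` be the probability that some bidder's type lies in `S`. Then `f` is submodular
(`hitProb_submodular`), and feasibility of `π` gives `x(S) ≤ f(S)` for all `S`
(`sum_winProb_le`). Every hierarchy `H` provides a point `c_H` of this polymatroid, the vector of
winning probabilities of its hierarchical mechanism; `c_H` satisfies the constraint of each set
`{H ≤ k}` with equality (`tightOn_winProb`) and vanishes on the losing elements.

The polymatroid is covered by the simplices spanned by the points `c_H` for chains of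
successively finer `H`, as in a barycentric subdivision (`exists_weights_of_tightOn`). Let `x` be
tight at the sets `{H ≤ k}`. If `x ≠ c_H`, follow the ray from `c_H` through `x` until it leaves
the polymatroid, at a point `y` where a new set `S` is tight. Tight sets form a lattice, so
splitting each level of `H` by `S` gives a strictly finer `H'` at whose sets `y` is tight, and `x`
lies on the segment from `c_H` to `y`. Iterating, starting with the hierarchy in which everything
loses, writes `x` as a convex combination of points `c_H` where all `H` are coarser than a single
one. Any total ordering `σ` extending the latter orders all of them.

Since `x` is matched exactly, `π` is the interim allocation of a mixture of `σ`-ordered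
hierarchical mechanisms, and for these a type earlier in `σ` wins at least as often as a later type
of the same bidder (`Hierarchy.interim_mono`). So `σ` respects `π`.

If some types have probability zero, `x` forgets `π` there. In that case the weights `D_i(A)` are
increased by `s > 0`, and `π` is lowered to its minimum with the interim allocation of a mechanism
that implements it, recomputed for the increased weights. None of the above needs the weights to
sum to one. As `s → 0`, some ordering recurs, the mixture weights accumulate by compactness, and
all conclusions pass to the limit.
-/

namespace SingleItem

/-! ### Level functions and their refinements -/

section Polymatroid

variable {E : Type*} [Fintype E] {N : ℕ}

/-- `H` refines `K`: whatever `K` separates strictly, `H` separates strictly in the same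
direction. -/
def Refines {α β : Type*} [Preorder α] [Preorder β] (H : E → α) (K : E → β) : Prop :=
  ∀ a b, K a < K b → H a < H b

/-- `x` meets the constraint `x(S) ≤ f(S)` with equality at every set of elements that are at
least as good as a given non-losing element. -/
def TightOn (f : Finset E → ℝ) (x : E → ℝ) (H : E → WithTop (Fin N)) : Prop :=
  ∀ e, H e ≠ ⊤ → ∑ a with H a ≤ H e, x a = f {a | H a ≤ H e}

/-- A level function into an arbitrary linear order may be compressed to `Fintype.card E` levels:
the level of `e` becomes the number of elements strictly better than `e`. -/
lemma exists_compress {α : Type*} [LinearOrder α] (hN : Fintype.card E = N) (G : E → WithTop α) :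
    ∃ H : E → WithTop (Fin N), (∀ a b, H a ≤ H b ↔ G a ≤ G b) ∧ ∀ a, H a = ⊤ ↔ G a = ⊤ := by
  classical
  subst hN
  have hlt : ∀ e, (Finset.univ.filter fun a => G a < G e).card < Fintype.card E := fun e =>
    Finset.card_lt_univ_of_notMem (x := e) (by simp)
  let H : E → WithTop (Fin (Fintype.card E)) := fun e =>
    if G e = ⊤ then ⊤ else ((⟨_, hlt e⟩ : Fin (Fintype.card E)) : WithTop _)
  have htop : ∀ a, H a = ⊤ ↔ G a = ⊤ := by
    intro a
    by_cases h : G a = ⊤ <;> simp [H, h]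
  refine ⟨H, fun a b => ?_, htop⟩
  by_cases hb : G b = ⊤
  · simp [(htop b).2 hb, hb]
  by_cases ha : G a = ⊤
  · rw [(htop a).2 ha, ha, top_le_iff, top_le_iff, htop]
  simp only [H, ha, hb, if_false, WithTop.coe_le_coe, Fin.mk_le_mk]
  constructor
  · intro h
    by_contra! hlt'
    refine absurd h (not_le.2 (Finset.card_lt_card ?_))
    refine (Finset.ssubset_iff_of_subset fun c => ?_).2 ⟨b, by simpa using hlt', by simp⟩
    simpa using fun hc => hc.trans hlt'
  · intro h
    refine Finset.card_le_card fun c => ?_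
    simpa using fun hc => lt_of_lt_of_le hc h

/-- Splitting every level of `H` into its part inside `S` followed by its part outside `S`. Among
the losing elements only those outside `S` keep losing. -/
lemma exists_split [DecidableEq E] (hN : Fintype.card E = N) (H : E → WithTop (Fin N))
    (S : Finset E) :
    ∃ H' : E → WithTop (Fin N), (∀ a b, H' a ≤ H' b ↔ H a < H b ∨ H a = H b ∧ (a ∈ S ∨ b ∉ S)) ∧
      ∀ a, H' a = ⊤ ↔ H a = ⊤ ∧ a ∉ S := by
  let G : E → WithTop (WithTop (Fin N) ×ₗ Bool) := fun e =>
    if H e = ⊤ ∧ e ∉ S then ⊤ else ((toLex (H e, decide (e ∉ S)) : WithTop (Fin N) ×ₗ Bool) :)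
  obtain ⟨H', h1, h2⟩ := exists_compress hN G
  have hG : ∀ a, G a = ⊤ ↔ H a = ⊤ ∧ a ∉ S := by
    intro a
    by_cases h : H a = ⊤ ∧ a ∉ S
    · simp only [G, if_pos h, h, true_iff]; simp
    · simp only [G, if_neg h, h, iff_false]; simp
  refine ⟨H', fun a b => ?_, fun a => (h2 a).trans (hG a)⟩
  rw [h1]
  by_cases hb : H b = ⊤ ∧ b ∉ S
  · rw [(hG b).2 hb]
    simp only [le_top, true_iff, hb.1, lt_top_iff_ne_top, hb.2]
    tauto
  by_cases ha : H a = ⊤ ∧ a ∉ S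
  · rw [(hG a).2 ha, top_le_iff, hG, ha.1]
    simp only [not_top_lt, false_or, ha.2, eq_comm]
  simp only [G, if_neg ha, if_neg hb, WithTop.coe_le_coe, Prod.Lex.le_iff, ofLex_toLex]
  by_cases h1 : a ∈ S <;> by_cases h2 : b ∈ S <;> simp [h1, h2]

/-! ### Tight sets of a polymatroid -/

/-- Uncrossing: for submodular `f`, the tight sets of a point of the polymatroid form a lattice. -/
lemma tight_union_inter {E : Type*} [DecidableEq E] {f : Finset E → ℝ} {x : E → ℝ}
    (hf : ∀ S R, f (S ∪ R) + f (S ∩ R) ≤ f S + f R) (hx : ∀ S : Finset E, ∑ a ∈ S, x a ≤ f S) {S R : Finset E} (hS : ∑ a ∈ S, x a = f S)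
    (hR : ∑ a ∈ R, x a = f R) :
    ∑ a ∈ S ∪ R, x a = f (S ∪ R) ∧ ∑ a ∈ S ∩ R, x a = f (S ∩ R) := by
  have h1 := Finset.sum_union_inter (s₁ := S) (s₂ := R) (f := x)
  have h2 := hx (S ∪ R)
  have h3 := hx (S ∩ R)
  have h4 := hf S R
  constructor <;> linarith

variable {f : Finset E → ℝ}

/-- The sets of strictly better elements are tight as well: each is empty or is one of the sets of
the definition. -/
lemma TightOn.lt {x : E → ℝ} {H : E → WithTop (Fin N)} (h : TightOn f x H) (h0 : f ∅ = 0)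
    (e : E) : ∑ a with H a < H e, x a = f {a | H a < H e} := by
  rcases (Finset.univ.filter fun a => H a < H e).eq_empty_or_nonempty with he | hne
  · simp [he, h0]
  · obtain ⟨b, hb, hmax⟩ := Finset.exists_max_image _ H hne
    have hb' : H b < H e := by simpa using hb
    have : (Finset.univ.filter fun a => H a < H e) = Finset.univ.filter fun a => H a ≤ H b := by
      ext a
      simp only [Finset.mem_filter, Finset.mem_univ, true_and] at hmax ⊢
      exact ⟨hmax a, fun h => h.trans_lt hb'⟩
    rw [this]
    exact h b hb'.ne_top

/-- Splitting along a tight set preserves tightness. -/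
lemma TightOn.split [DecidableEq E] {x : E → ℝ} {H H' : E → WithTop (Fin N)} {S : Finset E}
    (h : TightOn f x H) (h0 : f ∅ = 0) (hf : ∀ S R, f (S ∪ R) + f (S ∩ R) ≤ f S + f R)
    (hx : ∀ S : Finset E, ∑ a ∈ S, x a ≤ f S) (hS : ∑ a ∈ S, x a = f S)
    (hle : ∀ a b, H' a ≤ H' b ↔ H a < H b ∨ H a = H b ∧ (a ∈ S ∨ b ∉ S))
    (htop : ∀ a, H' a = ⊤ ↔ H a = ⊤ ∧ a ∉ S) : TightOn f x H' := by
  intro e he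
  rw [Ne, htop] at he
  by_cases heS : e ∈ S
  · by_cases hetop : H e = ⊤
    · have : (Finset.univ.filter fun a => H' a ≤ H' e)
          = (Finset.univ.filter fun a => H a < H e) ∪ S := by
        ext a
        have : H a < ⊤ ∨ H a = ⊤ := lt_or_eq_of_le le_top
        simp only [Finset.mem_filter, Finset.mem_univ, true_and, hle, heS, Finset.mem_union,
          hetop]
        tauto
      rw [this]
      exact (tight_union_inter hf hx (h.lt h0 e) hS).1
    · have : (Finset.univ.filter fun a => H' a ≤ H' e)
          = (Finset.univ.filter fun a => H a < H e)
            ∪ ((Finset.univ.filter fun a => H a ≤ H e) ∩ S) := by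
        ext a
        have : H a ≤ H e ↔ H a < H e ∨ H a = H e := le_iff_lt_or_eq
        simp only [Finset.mem_filter, Finset.mem_univ, true_and, hle, heS, Finset.mem_union,
          Finset.mem_inter]
        tauto
      rw [this]
      exact (tight_union_inter hf hx (h.lt h0 e) (tight_union_inter hf hx (h e hetop) hS).2).1
  · have : (Finset.univ.filter fun a => H' a ≤ H' e)
          = Finset.univ.filter fun a => H a ≤ H e := by
      ext a
      have : H a ≤ H e ↔ H a < H e ∨ H a = H e := le_iff_lt_or_eq
      simp only [Finset.mem_filter, Finset.mem_univ, true_and, hle, heS]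
      tauto
    rw [this]
    exact h e fun h => he ⟨h, heS⟩

/-- The total of each non-losing level is determined by tightness, so two tight points differ by a
vector that sums to zero on each such level. -/
lemma TightOn.sum_level {x c : E → ℝ} {H : E → WithTop (Fin N)} (hx : TightOn f x H)
    (hc : TightOn f c H) (h0 : f ∅ = 0) (e : E) (he : H e ≠ ⊤) :
    ∑ a with H a = H e, (x a - c a) = 0 := by
  classical
  have key : ∀ z : E → ℝ, ∑ a with H a ≤ H e, z a
      = ∑ a with H a < H e, z a + ∑ a with H a = H e, z a := by
    intro z
    rw [← Finset.sum_union]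
    · congr 1
      ext a
      simp [le_iff_lt_or_eq]
    · rw [Finset.disjoint_filter]
      exact fun a _ h => h.ne
  have h1 := key x
  have h2 := key c
  rw [hx e he, hx.lt h0 e] at h1
  rw [hc e he, hc.lt h0 e] at h2
  rw [Finset.sum_sub_distrib]
  linarith

lemma TightOn.sum_eq_zero {x c : E → ℝ} {H : E → WithTop (Fin N)} (hx : TightOn f x H)
    (hc : TightOn f c H) (h0 : f ∅ = 0) {S : Finset E} (hS : ∀ e ∈ S, H e ≠ ⊤)
    (hlev : ∀ a b, H a = H b → a ∈ S → b ∈ S) : ∑ a ∈ S, (x a - c a) = 0 := by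
  rw [← Finset.sum_fiberwise_of_maps_to (t := S.image H) (g := H)
    fun a ha => Finset.mem_image_of_mem H ha]
  refine Finset.sum_eq_zero fun k hk => ?_
  obtain ⟨e, he, rfl⟩ := Finset.mem_image.1 hk
  rw [← hx.sum_level hc h0 e (hS e he)]
  congr 1
  ext a
  simp only [Finset.mem_filter, Finset.mem_univ, true_and, and_iff_right_iff_imp]
  exact fun h => hlev _ _ h.symm he

/-! ### Covering a polymatroid by chains of faces -/

/-- The ray from `c` through `x`, two points of the polyhedron `{z | ∀ S, z(S) ≤ f(S)}`, leaves it
at a point beyond `x` at which some set becomes tight, provided some coordinate increases. -/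
lemma exists_ray_exit {x c : E → ℝ} (hx : ∀ S : Finset E, ∑ a ∈ S, x a ≤ f S)
    (hc : ∀ S : Finset E, ∑ a ∈ S, c a ≤ f S) (hpos : ∃ e, 0 < x e - c e) :
    ∃ r : ℝ, 1 ≤ r ∧ (∀ S : Finset E, ∑ a ∈ S, (c a + r * (x a - c a)) ≤ f S) ∧
      ∃ S : Finset E, 0 < ∑ a ∈ S, (x a - c a) ∧ ∑ a ∈ S, (c a + r * (x a - c a)) = f S := by
  obtain ⟨e, he⟩ := hpos
  obtain ⟨S, hS, hmin⟩ := Finset.exists_min_image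
    (Finset.univ.filter fun S : Finset E => 0 < ∑ a ∈ S, (x a - c a))
    (fun S => (f S - ∑ a ∈ S, c a) / ∑ a ∈ S, (x a - c a)) ⟨{e}, by simpa using he⟩
  simp only [Finset.mem_filter, Finset.mem_univ, true_and] at hS hmin
  have hexp : ∀ (r : ℝ) (R : Finset E), ∑ a ∈ R, (c a + r * (x a - c a))
      = ∑ a ∈ R, c a + r * ∑ a ∈ R, (x a - c a) := by
    intro r R
    rw [Finset.sum_add_distrib, Finset.mul_sum]
  have h1 : 1 ≤ (f S - ∑ a ∈ S, c a) / ∑ a ∈ S, (x a - c a) := by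
    rw [one_le_div hS, Finset.sum_sub_distrib]
    linarith [hx S]
  refine ⟨_, h1, fun R => ?_, S, hS, ?_⟩
  · rw [hexp]
    rcases lt_or_ge 0 (∑ a ∈ R, (x a - c a)) with hR | hR
    · have := hmin R hR
      rw [le_div_iff₀ hR] at this
      linarith
    · nlinarith [hc R]
  · rw [hexp, div_mul_cancel₀ _ hS.ne']
    ring

/-- A point of a polymatroid is a convex combination of canonical points `c H` of the faces
determined by a chain of level functions, all coarser than a single one. Nonnegativity of `x` is
only asked for on the losing elements: elsewhere it follows from tightness when `f` is monotone,
and the induction would have to reprove it for the points further along the ray. -/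
theorem exists_weights_of_tightOn [DecidableEq E] (hN : Fintype.card E = N) (h0 : f ∅ = 0)
    (hf : ∀ S R, f (S ∪ R) + f (S ∩ R) ≤ f S + f R)
    (c : (E → WithTop (Fin N)) → E → ℝ) (hcle : ∀ H, ∀ S : Finset E, ∑ a ∈ S, c H a ≤ f S)
    (hct : ∀ H, TightOn f (c H) H) (hc0 : ∀ H a, H a = ⊤ → c H a = 0)
    (x : E → ℝ) (H : E → WithTop (Fin N)) (hxle : ∀ S : Finset E, ∑ a ∈ S, x a ≤ f S)
    (hxt : TightOn f x H) (hx0 : ∀ a, H a = ⊤ → 0 ≤ x a) :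
    ∃ K : E → WithTop (Fin N), Refines K H ∧ ∃ w ∈ stdSimplex ℝ (E → WithTop (Fin N)),
      (∀ G, w G ≠ 0 → Refines K G) ∧ ∀ a, x a = ∑ G, w G * c G a := by
  -- Every split separates a new pair or rescues a losing element, so this count drops.
  induction hn : (Finset.univ.filter fun p : E × E => H p.1 ≤ H p.2).card
      + (Finset.univ.filter fun a => H a = ⊤).card using Nat.strong_induction_on
    generalizing x H with
  | _ n ih =>
  subst hn
  by_cases hxc : ∀ a, x a = c H a
  · refine ⟨H, fun _ _ h => h, Pi.single H 1, single_mem_stdSimplex ℝ H, fun G hG => ?_,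
      fun a => ?_⟩
    · have : G = H := by
        by_contra hne
        exact hG (Pi.single_eq_of_ne hne _)
      subst this
      exact fun _ _ h => h
    · simp [Pi.single_apply, hxc]
  -- `x - c H` is nonnegative on losing elements and sums to zero on every other level.
  have hpos : ∃ e, 0 < x e - c H e := by
    by_contra! hneg
    refine hxc fun a => ?_
    by_cases ha : H a = ⊤
    · have := hneg a
      have := hx0 a ha
      rw [hc0 H a ha] at *
      linarith
    · have := (Finset.sum_eq_zero_iff_of_nonpos fun b _ => hneg b).1
        (hxt.sum_level (hct H) h0 a ha) a (by simp)
      linarith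
  obtain ⟨r, hr, hyle, S, hSpos, hS⟩ := exists_ray_exit hxle (hcle H) hpos
  set y : E → ℝ := fun a => c H a + r * (x a - c H a) with hy
  have hyt : TightOn f y H := by
    intro e he
    have h1 := hxt e he
    have h2 := hct H e he
    simp only [hy]
    rw [Finset.sum_add_distrib, ← Finset.mul_sum, Finset.sum_sub_distrib, h1, h2]
    ring
  obtain ⟨H', hle, htop⟩ := exists_split hN H S
  have href : Refines H' H := by
    intro a b hab
    rw [← not_le] at hab ⊢
    rw [hle]
    rintro (h | h)
    · exact hab h.le
    · exact hab h.1.le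
  -- A set made up of entire non-losing levels has the same total at `x` and `c H`.
  have hnew : (∃ e ∈ S, H e = ⊤) ∨ ∃ a b, H a = H b ∧ a ∈ S ∧ b ∉ S := by
    by_contra! hcon
    exact hSpos.ne' (hxt.sum_eq_zero (hct H) h0 hcon.1 hcon.2)
  have hsub1 : (Finset.univ.filter fun p : E × E => H' p.1 ≤ H' p.2)
      ⊆ Finset.univ.filter fun p : E × E => H p.1 ≤ H p.2 := by
    intro p
    simp only [Finset.mem_filter, Finset.mem_univ, true_and, hle]
    rintro (h | h)
    · exact h.le
    · exact h.1.le
  have hsub2 : (Finset.univ.filter fun a => H' a = ⊤) ⊆ Finset.univ.filter fun a => H a = ⊤ := by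
    intro a
    simpa [htop] using fun h _ => h
  have hlt : (Finset.univ.filter fun p : E × E => H' p.1 ≤ H' p.2).card
      + (Finset.univ.filter fun a => H' a = ⊤).card
      < (Finset.univ.filter fun p : E × E => H p.1 ≤ H p.2).card
      + (Finset.univ.filter fun a => H a = ⊤).card := by
    rcases hnew with ⟨e, heS, he⟩ | ⟨a, b, hab, haS, hbS⟩
    · exact add_lt_add_of_le_of_lt (Finset.card_le_card hsub1) (Finset.card_lt_card
        ((Finset.ssubset_iff_of_subset hsub2).2 ⟨e, by simpa using he, by simp [htop, heS]⟩))
    · exact add_lt_add_of_lt_of_le (Finset.card_lt_card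
        ((Finset.ssubset_iff_of_subset hsub1).2 ⟨(b, a), by simp [hab], by
          simp [hle, hab, haS, hbS]⟩)) (Finset.card_le_card hsub2)
  obtain ⟨K, hKH', w, hw, hwK, hwy⟩ := ih _ hlt y H' hyle
    (hyt.split h0 hf hyle hS hle htop) (fun a ha => by
      have ha' := ((htop a).1 ha).1
      simp only [hy, hc0 H a ha']
      nlinarith [hx0 a ha']) rfl
  have hKH : Refines K H := fun a b h => hKH' a b (href a b h)
  -- `x` lies on the segment from `c H` to `y`.
  have hr0 : 0 < r := by linarith
  have hinv : r⁻¹ ≤ 1 := inv_le_one_of_one_le₀ hr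
  refine ⟨K, hKH, (1 - r⁻¹) • Pi.single H 1 + r⁻¹ • w,
    convex_stdSimplex ℝ _ (single_mem_stdSimplex ℝ H) hw (by linarith) (by positivity) (by ring),
    fun G hG => ?_, fun a => ?_⟩
  · by_cases hGH : G = H
    · exact hGH ▸ hKH
    · refine hwK G fun h => hG ?_
      simp [h, Pi.single_eq_of_ne hGH]
  · have h1 := hwy a
    simp only [hy] at h1
    simp only [Pi.add_apply, Pi.smul_apply, smul_eq_mul, add_mul, Finset.sum_add_distrib, mul_assoc,
      ← Finset.mul_sum, ← h1]
    simp only [Pi.single_apply, ite_mul, one_mul, zero_mul, Finset.sum_ite_eq', Finset.mem_univ,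
      if_true]
    field_simp
    ring

end Polymatroid

section Bidders

/-! ### Hierarchies and total orderings -/

variable {ι : Type*} [Fintype ι] {T : ι → Type*} [∀ i, Fintype (T i)]

lemma Hierarchy.mem_winners {H : Hierarchy T} {t : ∀ i, T i} {i : ι} :
    i ∈ H.winners t ↔ H ⟨i, t i⟩ ≠ ⊤ ∧ ∀ j, H ⟨i, t i⟩ ≤ H ⟨j, t j⟩ := by
  simp [Hierarchy.winners]

/-- The levels of `K` extend to a total ordering, ties being broken arbitrarily. -/
lemma exists_totalOrdering_refines (K : Hierarchy T) :
    ∃ σ : TotalOrdering T, Refines σ K := by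
  let e := Fintype.equivFinOfCardEq (α := Σ i, T i) (Fintype.card_sigma ..)
  let key : (Σ i, T i) → WithTop (Fin (∑ i, Fintype.card (T i))) ×ₗ
    Fin (∑ i, Fintype.card (T i)) := fun a => toLex (K a, e a)
  have hkey : Function.Injective key := by
    intro a b h
    exact e.injective (congrArg (fun p => (ofLex p).2) h)
  let _ : LinearOrder (Σ i, T i) := LinearOrder.lift' key hkey
  let o := Fintype.orderIsoFinOfCardEq (Σ i, T i) (Fintype.card_sigma ..)
  refine ⟨o.symm.toEquiv, fun a b hab => o.symm.lt_iff_lt.2 ?_⟩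
  exact Prod.Lex.toLex_lt_toLex.2 (Or.inl hab)

variable [DecidableEq ι]

lemma Hierarchy.sum_alloc_winners {H : Hierarchy T} {t : ∀ i, T i} (h : (H.winners t).Nonempty) :
    ∑ i ∈ H.winners t, H.toMechanism.alloc t i = 1 := by
  have : ∀ i ∈ H.winners t, H.toMechanism.alloc t i = ((H.winners t).card : ℝ)⁻¹ :=
    fun i hi => if_pos hi
  rw [Finset.sum_congr rfl this, Finset.sum_const, nsmul_eq_mul]
  exact mul_inv_cancel₀ (by exact_mod_cast h.card_pos.ne')

variable [∀ i, DecidableEq (T i)]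

/-! ### The polymatroid of winning probabilities -/

/-- The probability that the type of at least one bidder lies in `S`. The weights `D i` need not
sum to one, in which case this is the total product weight of such type profiles. -/
noncomputable def hitProb (D : ∀ i, T i → ℝ) (S : Finset (Σ i, T i)) : ℝ :=
  ∑ t : (∀ i, T i), (∏ i, D i (t i)) * if ∃ i, (⟨i, t i⟩ : Σ i, T i) ∈ S then 1 else 0

/-- The probability (for general `D`, the weight) of bidder `e.1` having type `e.2` and receiving
the item. -/
noncomputable def winProb (D : ∀ i, T i → ℝ) (M : Mechanism T) (e : Σ i, T i) : ℝ :=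
  D e.1 e.2 * M.interim D e.1 e.2

lemma hitProb_submodular (D : ∀ i, T i → ℝ) (hD : ∀ i A, 0 ≤ D i A)
    (S R : Finset (Σ i, T i)) :
    hitProb D (S ∪ R) + hitProb D (S ∩ R) ≤ hitProb D S + hitProb D R := by
  simp only [hitProb, ← Finset.sum_add_distrib, ← mul_add]
  refine Finset.sum_le_sum fun t _ => mul_le_mul_of_nonneg_left ?_
    (Finset.prod_nonneg fun i _ => hD i _)
  by_cases hS : ∃ i, (⟨i, t i⟩ : Σ i, T i) ∈ S
  · by_cases hR : ∃ i, (⟨i, t i⟩ : Σ i, T i) ∈ R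
    · rw [if_pos hS, if_pos hR]
      split_ifs <;> norm_num
    · rw [if_pos hS, if_neg hR, if_neg (c := ∃ i, _ ∈ S ∩ R)]
      · split_ifs <;> norm_num
      · rintro ⟨i, hi⟩
        exact hR ⟨i, (Finset.mem_inter.1 hi).2⟩
  · rw [if_neg hS, if_neg (c := ∃ i, _ ∈ S ∩ R)]
    · simp only [Finset.mem_union]
      split_ifs with h1 h2 h2 <;> try norm_num
      obtain ⟨i, hi⟩ := h1
      exact hi.elim (fun h => hS ⟨i, h⟩) fun h => h2 ⟨i, h⟩
    · rintro ⟨i, hi⟩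
      exact hS ⟨i, (Finset.mem_inter.1 hi).1⟩

lemma sum_winProb (D : ∀ i, T i → ℝ) (M : Mechanism T) (S : Finset (Σ i, T i)) :
    ∑ e ∈ S, winProb D M e = ∑ t : (∀ i, T i), (∏ i, D i (t i)) *
      ∑ i, if (⟨i, t i⟩ : Σ i, T i) ∈ S then M.alloc t i else 0 := by
  have h1 : ∀ e : Σ i, T i, winProb D M e
      = ∑ t : (∀ i, T i), if t e.1 = e.2 then (∏ i, D i (t i)) * M.alloc t e.1 else 0 := by
    intro e
    rw [winProb, Mechanism.interim, Finset.mul_sum, Finset.sum_filter]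
    refine Finset.sum_congr rfl fun t _ => ?_
    split_ifs with h
    · rw [← Finset.mul_prod_erase _ _ (Finset.mem_univ e.1), h, mul_assoc]
    · rfl
  rw [Finset.sum_congr rfl fun e _ => h1 e, Finset.sum_comm]
  refine Finset.sum_congr rfl fun t _ => ?_
  rw [← Finset.sum_filter, Finset.mul_sum]
  simp only [mul_ite, mul_zero]
  rw [← Finset.sum_filter]
  -- The type profile `t` picks one element of `S` for each bidder `i` with `⟨i, t i⟩ ∈ S`.
  refine Finset.sum_bij' (fun e _ => e.1) (fun i _ => ⟨i, t i⟩) ?_ ?_ ?_ ?_ ?_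
  · rintro ⟨i, A⟩ he
    obtain ⟨heS, hA⟩ := Finset.mem_filter.1 he
    dsimp only at hA
    subst hA
    exact Finset.mem_filter.2 ⟨Finset.mem_univ i, heS⟩
  · intro i hi
    exact Finset.mem_filter.2 ⟨(Finset.mem_filter.1 hi).2, rfl⟩
  · rintro ⟨i, A⟩ he
    exact congrArg (Sigma.mk i) (Finset.mem_filter.1 he).2
  · exact fun _ _ => rfl
  · exact fun _ _ => rfl

/-- The necessary half of Border's condition: the types in `S` cannot win more often than one of
them occurs. -/
lemma sum_winProb_le (D : ∀ i, T i → ℝ) (hD : ∀ i A, 0 ≤ D i A) (M : Mechanism T)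
    (S : Finset (Σ i, T i)) : ∑ e ∈ S, winProb D M e ≤ hitProb D S := by
  rw [sum_winProb, hitProb]
  refine Finset.sum_le_sum fun t _ => mul_le_mul_of_nonneg_left ?_
    (Finset.prod_nonneg fun i _ => hD i _)
  split_ifs with h
  · refine le_trans (Finset.sum_le_sum fun i _ => ?_) (M.sum_alloc_le_one t)
    split_ifs
    · exact le_rfl
    · exact M.alloc_nonneg t i
  · push Not at h
    exact (Finset.sum_eq_zero fun i _ => if_neg (h i)).le

/-- A hierarchical mechanism never misses a bidder whose type is at least as good as a given
non-losing one: whenever there is such a bidder, the item goes to one of them. -/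
lemma tightOn_winProb (D : ∀ i, T i → ℝ) (H : Hierarchy T) :
    TightOn (hitProb D) (winProb D H.toMechanism) H := by
  intro e he
  rw [sum_winProb, hitProb]
  refine Finset.sum_congr rfl fun t _ => congrArg _ ?_
  simp only [Finset.mem_filter, Finset.mem_univ, true_and]
  split_ifs with h
  · obtain ⟨j, hj⟩ := h
    obtain ⟨i, -, hmin⟩ := Finset.exists_min_image Finset.univ (fun i => H ⟨i, t i⟩)
      ⟨j, Finset.mem_univ j⟩
    have hie : H ⟨i, t i⟩ ≤ H e := (hmin j (Finset.mem_univ j)).trans hj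
    have hi : i ∈ H.winners t := Hierarchy.mem_winners.2
      ⟨ne_top_of_le_ne_top he hie, fun k => hmin k (Finset.mem_univ k)⟩
    rw [← Hierarchy.sum_alloc_winners ⟨i, hi⟩,
      ← Finset.sum_subset (Finset.subset_univ (H.winners t))]
    · refine Finset.sum_congr rfl fun k hk => if_pos ?_
      exact ((Hierarchy.mem_winners.1 hk).2 i).trans hie
    · intro k _ hk
      have : H.toMechanism.alloc t k = 0 := if_neg hk
      simp [this]
  · push Not at h
    exact Finset.sum_eq_zero fun i _ => if_neg (not_le.2 (h i))

lemma winProb_eq_zero (D : ∀ i, T i → ℝ) (H : Hierarchy T) (e : Σ i, T i) (he : H e = ⊤) :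
    winProb D H.toMechanism e = 0 := by
  rw [winProb, Mechanism.interim, Finset.sum_eq_zero, mul_zero]
  intro t ht
  have ht' : t e.1 = e.2 := (Finset.mem_filter.1 ht).2
  have : H.toMechanism.alloc t e.1 = 0 := if_neg fun h => (Hierarchy.mem_winners.1 h).1 (by
    rw [ht']; exact he)
  rw [this, mul_zero]

/-! ### Interim allocations of hierarchical mechanisms -/

lemma interim_mixture (D : ∀ i, T i → ℝ) (w : Hierarchy T → ℝ)
    (hw : w ∈ stdSimplex ℝ (Hierarchy T)) (i : ι) (A : T i) :
    (mixture w hw).interim D i A = ∑ H, w H * H.toMechanism.interim D i A := by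
  simp only [Mechanism.interim, mixture, Finset.mul_sum]
  rw [Finset.sum_comm]
  exact Finset.sum_congr rfl fun H _ => Finset.sum_congr rfl fun t _ => by ring

/-- A better level for a type can only raise the bidder's winning probability. -/
lemma Hierarchy.interim_mono (D : ∀ i, T i → ℝ) (hD : ∀ i A, 0 ≤ D i A) (H : Hierarchy T) (i : ι)
    (A B : T i) (h : H ⟨i, B⟩ ≤ H ⟨i, A⟩) :
    H.toMechanism.interim D i A ≤ H.toMechanism.interim D i B := by
  have hmaps : ∀ C C' : T i, ∀ t ∈ Finset.univ.filter (fun t : (∀ j, T j) => t i = C),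
      Function.update (Function.update t i C') i C = t := by
    intro C C' t ht
    rw [Function.update_idem, ← (Finset.mem_filter.1 ht).2, Function.update_eq_self]
  -- Compare profile by profile, replacing the type `A` of bidder `i` by `B`.
  have hbij : H.toMechanism.interim D i B
      = ∑ t : (∀ j, T j) with t i = A, (∏ j ∈ Finset.univ.erase i, D j (t j))
        * H.toMechanism.alloc (Function.update t i B) i := by
    symm
    refine Finset.sum_bij' (fun t _ => Function.update t i B) (fun t _ => Function.update t i A)
      (by simp) (by simp) (hmaps A B) (hmaps B A) fun t _ => ?_
    congr 1
    refine Finset.prod_congr rfl fun j hj => ?_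
    rw [Function.update_of_ne (Finset.ne_of_mem_erase hj)]
  rw [hbij]
  refine Finset.sum_le_sum fun t ht => mul_le_mul_of_nonneg_left ?_
    (Finset.prod_nonneg fun i _ => hD i _)
  obtain rfl : t i = A := (Finset.mem_filter.1 ht).2
  set u := Function.update t i B with hu
  have hui : u i = B := Function.update_self ..
  have huj : ∀ j, j ≠ i → u j = t j := fun j hj => Function.update_of_ne hj ..
  by_cases hw : i ∈ H.winners t
  · have hw' := Hierarchy.mem_winners.1 hw
    have hwu : i ∈ H.winners u := by
      refine Hierarchy.mem_winners.2 ⟨?_, fun j => ?_⟩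
      · rw [hui]
        exact ne_top_of_le_ne_top hw'.1 h
      · by_cases hj : j = i
        · subst hj; exact le_rfl
        · rw [huj j hj, hui]
          exact h.trans (hw'.2 j)
    have hsub : H.winners u ⊆ H.winners t := by
      intro j hj
      by_cases hji : j = i
      · subst hji; exact hw
      have hj' := Hierarchy.mem_winners.1 hj
      rw [huj j hji] at hj'
      have hjt : H ⟨j, t j⟩ ≤ H ⟨i, t i⟩ := by
        have := hj'.2 i
        rw [hui] at this
        exact this.trans h
      exact Hierarchy.mem_winners.2 ⟨hj'.1, fun k => hjt.trans (hw'.2 k)⟩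
    have e1 : H.toMechanism.alloc t i = ((H.winners t).card : ℝ)⁻¹ := if_pos hw
    have e2 : H.toMechanism.alloc u i = ((H.winners u).card : ℝ)⁻¹ := if_pos hwu
    rw [e1, e2]
    refine inv_anti₀ ?_ (by exact_mod_cast Finset.card_le_card hsub)
    exact_mod_cast Finset.card_pos.2 ⟨i, hwu⟩
  · have e1 : H.toMechanism.alloc t i = 0 := if_neg hw
    rw [e1]
    exact H.toMechanism.alloc_nonneg u i

/-! ### Exact implementation, and passage to zero-probability types -/

/-- When all types have positive probability, a feasible reduced form is implemented exactly by
hierarchical mechanisms ordered by a common `σ`; exactness forces `σ` to respect `π`. -/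
theorem exists_respects_of_pos (D : ∀ i, T i → ℝ) (hD : ∀ i A, 0 < D i A)
    (π : ∀ i, T i → ℝ) (hπ : ∀ i A, 0 ≤ π i A) (hfeas : Feasible D π) :
    ∃ σ : TotalOrdering T, σ.Respects π ∧ ∃ w ∈ stdSimplex ℝ (Hierarchy T),
      (∀ H : Hierarchy T, w H ≠ 0 → H.IsOrdered σ) ∧
      ∀ i A, π i A = ∑ H : Hierarchy T, w H * H.toMechanism.interim D i A := by
  obtain ⟨M, hM⟩ := hfeas
  have hD' : ∀ i A, 0 ≤ D i A := fun i A => (hD i A).le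
  obtain ⟨K, -, w, hw, hwK, hx⟩ := exists_weights_of_tightOn (E := Σ i, T i)
    (Fintype.card_sigma ..) (f := hitProb D) (by simp [hitProb]) (hitProb_submodular D hD')
    (fun H => winProb D (Hierarchy.toMechanism H)) (fun H => sum_winProb_le D hD' _)
    (tightOn_winProb D) (fun H e => winProb_eq_zero D H e) (fun e => D e.1 e.2 * π e.1 e.2)
    (fun _ => ⊤)
    (fun S => (Finset.sum_le_sum fun e _ => mul_le_mul_of_nonneg_left (hM e.1 e.2)
      (hD' e.1 e.2)).trans (sum_winProb_le D hD' M S))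
    (fun e he => absurd rfl he) (fun e _ => mul_nonneg (hD' _ _) (hπ _ _))
  obtain ⟨σ, hσ⟩ := exists_totalOrdering_refines K
  have hord : ∀ H : Hierarchy T, w H ≠ 0 → H.IsOrdered σ := by
    intro H hH a b hab
    by_contra! hlt
    exact absurd (hσ _ _ (hwK H hH _ _ hlt)) (not_lt.2 hab.le)
  have hexact : ∀ i A, π i A = ∑ H : Hierarchy T, w H * H.toMechanism.interim D i A := by
    intro i A
    have h := hx ⟨i, A⟩
    refine mul_left_cancel₀ (hD i A).ne' (h.trans ?_)
    rw [Finset.mul_sum]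
    exact Finset.sum_congr rfl fun H _ => mul_left_comm ..
  refine ⟨σ, fun i A B hBA => ?_, w, hw, hord, hexact⟩
  by_contra! hle
  refine absurd hBA (not_lt.2 ?_)
  have hne : (⟨i, B⟩ : Σ i, T i) ≠ ⟨i, A⟩ := by
    rintro h
    obtain rfl : B = A := by simpa using h
    exact lt_irrefl _ hBA
  have hlt : σ ⟨i, B⟩ < σ ⟨i, A⟩ := lt_of_le_of_ne hle (σ.injective.ne hne)
  rw [hexact i A, hexact i B]
  refine Finset.sum_le_sum fun H _ => ?_
  by_cases hH : w H = 0
  · simp [hH]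
  · exact mul_le_mul_of_nonneg_left (Hierarchy.interim_mono D hD' H i A B (hord H hH _ _ hlt))
      (hw.1 H)

lemma continuous_interim {X : Type*} [TopologicalSpace X] (D : X → ∀ i, T i → ℝ)
    (hD : ∀ i A, Continuous fun s => D s i A) (M : Mechanism T) (i : ι) (A : T i) :
    Continuous fun s => M.interim (D s) i A := by
  unfold Mechanism.interim
  exact continuous_finsetSum _ fun t _ =>
    (continuous_finsetProd _ fun j _ => hD j _).mul continuous_const

end Bidders

end SingleItem

open Filter in
theorem mainTheorem3 {ι : Type*} [Fintype ι] [DecidableEq ι]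
    {T : ι → Type*} [∀ i, Fintype (T i)] [∀ i, DecidableEq (T i)]
    (D : ∀ i, T i → ℝ) (hD : ∀ i, D i ∈ stdSimplex ℝ (T i))
    (π : ∀ i, T i → ℝ) (hπ : SingleItem.IsReducedForm π)
    (hfeas : SingleItem.Feasible D π) :
    ∃ σ : SingleItem.TotalOrdering T, σ.Respects π ∧
      ∃ (w : SingleItem.Hierarchy T → ℝ) (hw : w ∈ stdSimplex ℝ (SingleItem.Hierarchy T)),
        (∀ H : SingleItem.Hierarchy T, w H ≠ 0 → H.IsOrdered σ) ∧
        (SingleItem.mixture w hw).Implements D π := by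
  obtain ⟨M, hM⟩ := hfeas
  -- Positive weights `D' s` for `s > 0`, and a reduced form `ρ s` that `M` implements for `D' s`.
  let D' : ℝ → ∀ i, T i → ℝ := fun s i A => D i A + s
  have hD'c : ∀ i A, Continuous fun s => D' s i A := fun i A => continuous_const.add continuous_id
  have hD'0 : D' 0 = D := by
    funext i A
    exact add_zero _
  let ρ : ℝ → ∀ i, T i → ℝ := fun s i A => min (π i A) (M.interim (D' s) i A)
  have hρc : ∀ i A, Continuous fun s => ρ s i A := fun i A =>
    continuous_const.min (SingleItem.continuous_interim D' hD'c M i A)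
  have hρ0 : ρ 0 = π := by
    funext i A
    simp only [ρ, hD'0]
    exact min_eq_left (hM i A)
  have hD'pos : ∀ s, 0 < s → ∀ i A, 0 < D' s i A := fun s hs i A =>
    add_pos_of_nonneg_of_pos ((hD i).1 A) hs
  have hρnonneg : ∀ s, 0 < s → ∀ i A, 0 ≤ ρ s i A := fun s hs i A =>
    le_min (hπ i A).1 (Finset.sum_nonneg fun t _ => mul_nonneg
      (Finset.prod_nonneg fun j _ => (hD'pos s hs j _).le) (M.alloc_nonneg t i))
  let s : ℕ → ℝ := fun n => 1 / ((n : ℝ) + 1)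
  have hs : ∀ n, 0 < s n := fun n => Nat.one_div_pos_of_nat
  choose σ hσ w hw hord hexact using fun n => SingleItem.exists_respects_of_pos (D' (s n))
    (hD'pos _ (hs n)) (ρ (s n)) (hρnonneg _ (hs n)) ⟨M, fun i A => min_le_right _ _⟩
  -- Along an ultrafilter the ordering is constant and the weights converge.
  let U : Ultrafilter ℕ := hyperfilter ℕ
  have hsU : Tendsto s U (nhds 0) :=
    (tendsto_one_div_add_atTop_nhds_zero_nat (𝕜 := ℝ)).mono_left Nat.hyperfilter_le_atTop
  obtain ⟨τ, hτ⟩ : ∃ τ, ∀ᶠ n in (U : Filter ℕ), σ n = τ :=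
    Ultrafilter.eventually_exists_iff.1 (Eventually.of_forall fun n => ⟨σ n, rfl⟩)
  obtain ⟨v, hv, hlim⟩ := (isCompact_stdSimplex ℝ (SingleItem.Hierarchy T)).ultrafilter_le_nhds
    (U.map w) (le_principal_iff.2 (Eventually.of_forall hw : ∀ᶠ n in (U : Filter ℕ), w n ∈ _))
  have hlim' : ∀ H, Tendsto (fun n => w n H) U (nhds (v H)) := tendsto_pi_nhds.1 hlim
  have hρlim : ∀ i A, Tendsto (fun n => ρ (s n) i A) U (nhds (π i A)) := by
    intro i A
    have := ((hρc i A).tendsto 0).comp hsU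
    rwa [hρ0] at this
  refine ⟨τ, fun i A B hBA => ?_, v, hv, fun H hH => ?_, fun i A => ?_⟩
  · obtain ⟨n, hn, hlt⟩ := (hτ.and ((hρlim i B).eventually_lt (hρlim i A) hBA)).exists
    exact hn ▸ hσ n i A B hlt
  · obtain ⟨n, hn, hne⟩ := (hτ.and ((hlim' H).eventually_ne hH)).exists
    exact hn ▸ hord n H hne
  · rw [SingleItem.interim_mixture]
    refine (tendsto_nhds_unique (hρlim i A) ?_).le
    simp only [hexact]
    refine tendsto_finsetSum _ fun H _ => (hlim' H).mul ?_
    have := ((SingleItem.continuous_interim D' hD'c H.toMechanism i A).tendsto 0).comp hsU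
    rwa [hD'0] at this
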